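/- Theorem 1.2. Write $\mathrm{C}_n$ for the cyclic group of order $n$ and $\mathrm{A}_5$ for the alternating group of degree $5$; write $N{:}G$ and $N{}^{\boldsymbol{\cdot}}G$ for a split, respectively non-split, extension of $N$ (the normal subgroup) by $G$ (the quotient). A permutation group on a finite set is called elusive if it is transitive and contains no derangement (fixed-point-free permutation) of prime order. There exist an elusive group $X_1$ of degree $3^2\cdot 5^2=225$ and an elusive group $X_2$ of degree $2\cdot 3^2\cdot 5^2=450$, isomorphic as abstract groups, such that both have the form $(\mathrm{C}_3^4\times \mathrm{C}_5^3){}^{\boldsymbol{\cdot}}\mathrm{A}_5$, the point stabilizers in $X_1$ have the form $(\mathrm{C}_3^3\times \mathrm{C}_5^2){:}\mathrm{C}_2^2$, and the point stabilizers in $X_2$ have the form $(\mathrm{C}_3^3\times \mathrm{C}_5^2){:}\mathrm{C}_2$. -/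

import Mathlib

/-- The cyclic group of order `n` (for `n ≥ 1`), written multiplicatively. -/
abbrev CyclicGrp (n : ℕ) : Type := Multiplicative (ZMod n)

/-- A permutation group `G` on a finite set `Ω` is elusive if it is transitive and contains no
derangement (fixed-point-free permutation) of prime order. -/
def IsElusive {Ω : Type*} [Finite Ω] (G : Subgroup (Equiv.Perm Ω)) : Prop :=
  MulAction.IsPretransitive G Ω ∧
    ∀ g ∈ G, (orderOf g).Prime → g ∉ derangements Ω

/-- `X` has the form `N:G`: it is a split extension of the normal subgroup `N` by `G`, that is,
there is a short exact sequence `1 → N → X → G → 1` with a homomorphic section. -/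
def IsSplitExtensionOf (X N G : Type*) [Group X] [Group N] [Group G] : Prop :=
  ∃ S : GroupExtension N X G, Nonempty S.Splitting

/-- `X` has the form `N·G`: it is a non-split extension of the normal subgroup `N` by `G`, that
is, there is a short exact sequence `1 → N → X → G → 1` with no homomorphic section. -/
def IsNonSplitExtensionOf (X N G : Type*) [Group X] [Group N] [Group G] : Prop :=
  ∃ S : GroupExtension N X G, IsEmpty S.Splitting

/-! The fifteen norm-one axes of `𝔽₅³` form five orthonormal frames. A copy of `A₅` in `SO₃(5)`
permutes the frames and preserves a cyclic order of the axes in each, so it also maps to `C₃ ≀ A₅`.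
`bigGroup` lifts both pictures at once: matrices to orthogonal ones over `ℤ/25`, rotation amounts to
`ℤ/9` with sum zero. The kernel over `A₅` consists of the matrices `1 + 5·(skew)` and the
coordinates in `3ℤ/9`, that is, `C₃⁴ × C₅³`.

The lifts are chosen so that no element outside the kernel has order 3 or 5
(`proj_eq_one_of_pow_three`, `proj_eq_one_of_pow_five`); in particular the extension does not split.
All involutions are conjugate (`exists_conj_eq_kleinA`).

A point stabilizer is a hyperplane of `𝔽₃⁴` times a hyperplane of `𝔽₅³`, extended by a Klein
four-group or by one involution. The conjugates of each hyperplane cover their space, so every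
element of prime order fixes a point; they also intersect trivially, and with the simplicity of `A₅`
this makes the coset action faithful. -/

open Equiv Matrix

/-! ### Extensions, coset actions and involutions in general groups -/

section GroupTheory

variable {X Y N K A : Type*} [Group X] [Group Y] [Group N] [Group K] [Group A]

/-- Transport of a group extension along an isomorphism of the middle groups. -/
def GroupExtension.congrMid (S : GroupExtension N X A) (e : X ≃* Y) : GroupExtension N Y A where
  inl := e.toMonoidHom.comp S.inl
  rightHom := S.rightHom.comp e.symm.toMonoidHom
  inl_injective := e.injective.comp S.inl_injective
  range_inl_eq_ker_rightHom := by
    ext y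
    have h : e.symm y ∈ S.inl.range ↔ e.symm y ∈ S.rightHom.ker := by
      rw [S.range_inl_eq_ker_rightHom]
    simp only [MonoidHom.mem_ker, MonoidHom.mem_range, MulEquiv.eq_symm_apply] at h ⊢
    exact h
  rightHom_surjective := S.rightHom_surjective.comp e.symm.surjective

theorem IsSplitExtensionOf.of_mulEquiv (h : IsSplitExtensionOf X N A) (e : X ≃* Y) :
    IsSplitExtensionOf Y N A := by
  obtain ⟨S, ⟨s⟩⟩ := h
  refine ⟨S.congrMid e, ⟨⟨e.toMonoidHom.comp s.toMonoidHom, fun g => ?_⟩⟩⟩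
  have := s.rightInverse_rightHom g
  change S.rightHom (e.symm (e (s.toMonoidHom g))) = g
  rw [e.symm_apply_apply]
  exact this

theorem IsNonSplitExtensionOf.of_mulEquiv (h : IsNonSplitExtensionOf X N A) (e : X ≃* Y) :
    IsNonSplitExtensionOf Y N A := by
  obtain ⟨S, hS⟩ := h
  refine ⟨S.congrMid e, ⟨fun s => hS.false ?_⟩⟩
  refine ⟨e.symm.toMonoidHom.comp s.toMonoidHom, fun g => ?_⟩
  exact s.rightInverse_rightHom g

/-- A subgroup consisting of the products `ι u * s k`, where `ι` and `s` have independent images,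
is a split extension. -/
theorem isSplitExtensionOf_of_mem_iff (H : Subgroup X) (ι : N →* X) (s : K →* X) (π : X →* A)
    (hι : Function.Injective ι) (hπι : ∀ u, π (ι u) = 1)
    (hπs : Function.Injective (π.comp s)) (hH : ∀ h, h ∈ H ↔ ∃ u k, h = ι u * s k) :
    IsSplitExtensionOf H N K := by
  have hιH : ∀ u, ι u ∈ H := fun u => (hH _).2 ⟨u, 1, by simp⟩
  have hsH : ∀ k, s k ∈ H := fun k => (hH _).2 ⟨1, k, by simp⟩
  have hmem : ∀ h : H, ∃ k, π h = π (s k) := by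
    rintro ⟨h, hh⟩
    obtain ⟨u, k, rfl⟩ := (hH h).1 hh
    exact ⟨k, by simp [hπι]⟩
  -- Injectivity of `π ∘ s` makes the `K`-component unique, so it is a homomorphism.
  choose r hr using hmem
  let ρ : H →* K :=
    { toFun := r
      map_one' := hπs (by simpa using (hr 1).symm)
      map_mul' := fun a b => hπs (by
        simp only [MonoidHom.comp_apply, map_mul, ← hr, Subgroup.coe_mul]) }
  have hρ : ∀ h : H, π h = π (s (ρ h)) := hr
  have hρs : ∀ k, ρ ⟨s k, hsH k⟩ = k := fun k => hπs (hρ ⟨s k, hsH k⟩).symm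
  refine ⟨⟨ι.codRestrict H hιH, ρ, fun a b hab => hι (congrArg Subtype.val hab), ?_,
    fun k => ⟨_, hρs k⟩⟩, ⟨⟨s.codRestrict H hsH, hρs⟩⟩⟩
  ext h
  rw [MonoidHom.mem_range, MonoidHom.mem_ker]
  constructor
  · rintro ⟨u, rfl⟩
    refine hπs ?_
    have := hρ (ι.codRestrict H hιH u)
    rw [MonoidHom.comp_apply, ← this]
    simp [hπι]
  · intro h1
    obtain ⟨u, k, huk⟩ := (hH h).1 h.2
    have hk : k = 1 := by
      refine hπs ?_
      have := hρ h
      rw [h1, huk, map_mul, hπι, one_mul] at this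
      simpa using this
    refine ⟨u, Subtype.ext ?_⟩
    rw [huk, hk]
    simp

theorem card_of_mem_iff (H : Subgroup X) (ι : N →* X) (s : K →* X) (π : X →* A)
    (hι : Function.Injective ι) (hπι : ∀ u, π (ι u) = 1)
    (hπs : Function.Injective (π.comp s)) (hH : ∀ h, h ∈ H ↔ ∃ u k, h = ι u * s k) :
    Nat.card H = Nat.card N * Nat.card K := by
  rw [← Nat.card_prod]
  refine (Nat.card_eq_of_bijective
    (fun p : N × K => (⟨ι p.1 * s p.2, (hH _).2 ⟨_, _, rfl⟩⟩ : H)) ⟨?_, ?_⟩).symm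
  · rintro ⟨u, k⟩ ⟨u', k'⟩ h
    have h' : ι u * s k = ι u' * s k' := congrArg Subtype.val h
    have hk : k = k' := hπs (by simpa [hπι] using congrArg π h')
    subst hk
    exact Prod.ext (hι (mul_right_cancel h')) rfl
  · rintro ⟨h, hh⟩
    obtain ⟨u, k, rfl⟩ := (hH h).1 hh
    exact ⟨(u, k), rfl⟩

/-- The coset action on a core-free subgroup meeting every conjugacy class of elements of prime
order is elusive. -/
theorem exists_isElusive_of_normalCore_eq_bot [Finite X] (H : Subgroup X) {n : ℕ}
    (hn : H.index = n) (hcore : H.normalCore = ⊥)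
    (hconj : ∀ g : X, (orderOf g).Prime → ∃ x, x * g * x⁻¹ ∈ H) :
    ∃ P : Subgroup (Perm (Fin n)), Nonempty (X ≃* P) ∧ IsElusive P ∧
      ∀ ω : Fin n, Nonempty (H ≃* MulAction.stabilizer P ω) := by
  let e : X ⧸ H ≃ Fin n := Finite.equivFinOfCardEq hn
  let ρ : X →* Perm (Fin n) := e.permCongrHom.toMonoidHom.comp (MulAction.toPermHom X (X ⧸ H))
  have hρ : ∀ x ω, ρ x ω = e (x • e.symm ω) := fun x ω => rfl
  have hinj : Function.Injective ρ := by
    refine e.permCongrHom.injective.comp ?_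
    rw [← MonoidHom.ker_eq_bot_iff, ← Subgroup.normalCore_eq_ker, hcore]
  let ψ : X ≃* ρ.range := MonoidHom.ofInjective hinj
  have hψ : ∀ x ω, ψ x • ω = e (x • e.symm ω) := fun x ω => rfl
  have hcoset : ∀ ω, ∃ x : X, e.symm ω = (x : X ⧸ H) := fun ω =>
    ⟨_, (QuotientGroup.out_eq' (e.symm ω)).symm⟩
  refine ⟨ρ.range, ⟨ψ⟩, ⟨⟨fun a b => ?_⟩, ?_⟩, fun ω => ?_⟩
  · obtain ⟨x, hx⟩ := MulAction.exists_smul_eq X (e.symm a) (e.symm b)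
    exact ⟨ψ x, by rw [hψ, hx, e.apply_symm_apply]⟩
  · rintro _ ⟨g, rfl⟩ hg hd
    rw [orderOf_injective ρ hinj] at hg
    obtain ⟨x, hx⟩ := hconj g hg
    -- The coset `x⁻¹H` is fixed by `g`, because `x * g * x⁻¹ ∈ H`.
    refine hd (e (x⁻¹ : X)) ?_
    rw [hρ, e.symm_apply_apply]
    congr 1
    rw [MulAction.Quotient.smul_coe, QuotientGroup.eq, smul_eq_mul]
    simpa [mul_assoc] using inv_mem hx
  · obtain ⟨x, hx⟩ := hcoset ω
    let f : X →* ρ.range := ψ.toMonoidHom.comp (MulAut.conj x).toMonoidHom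
    have hf : Function.Injective f := ψ.injective.comp (MulAut.conj x).injective
    have hstab : H.map f = MulAction.stabilizer ρ.range ω := by
      ext p
      obtain ⟨y, rfl⟩ := ψ.surjective p
      rw [MulAction.mem_stabilizer_iff, hψ, ← e.eq_symm_apply, hx, MulAction.Quotient.smul_coe,
        eq_comm, QuotientGroup.eq, Subgroup.mem_map]
      constructor
      · rintro ⟨h, hh, hy⟩
        have : x * h * x⁻¹ = y := ψ.injective hy
        subst this
        simpa [mul_assoc] using hh
      · intro h
        refine ⟨_, h, ?_⟩
        change ψ (x * (x⁻¹ * (y • x)) * x⁻¹) = ψ y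
        simp
    exact ⟨(H.equivMapOfInjective f hf).trans (MulEquiv.subgroupCongr hstab)⟩

/-- Two involutions that agree modulo a normal subgroup of exponent dividing `15` are conjugate. -/
theorem conj_eq_of_mul_pow_fifteen {g t : X} (hg : g * g = 1) (ht : t * t = 1)
    (h : (g * t) ^ 15 = 1) : (g * t) ^ 7 * g * ((g * t) ^ 7)⁻¹ = t := by
  -- Dihedral computation: `g` inverts `c = g * t`, so the conjugate is `c ^ 14 * g = c⁻¹ * g = t`.
  have hinv : ((g * t) ^ 7)⁻¹ = (t * g) ^ 7 := by
    rw [← inv_pow, _root_.mul_inv_rev, inv_eq_of_mul_eq_one_left hg, inv_eq_of_mul_eq_one_left ht]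
  have hsemi : g * (t * g) ^ 7 = (g * t) ^ 7 * g :=
    SemiconjBy.pow_right (show g * (t * g) = g * t * g from (mul_assoc g t g).symm) 7
  have h14 : (g * t) ^ 14 = t * g := by
    rw [eq_inv_of_mul_eq_one_left (show (g * t) ^ 14 * (g * t) = 1 by rw [← pow_succ, h]),
      _root_.mul_inv_rev, inv_eq_of_mul_eq_one_left hg, inv_eq_of_mul_eq_one_left ht]
  rw [hinv, mul_assoc, hsemi, ← mul_assoc, ← pow_add, h14, mul_assoc, hg, mul_one]

/-- The homomorphism from the elementary abelian group of order `4` given by two commuting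
involutions. -/
def kleinFourHom (a b : X) (ha : a * a = 1) (hb : b * b = 1) (hab : a * b = b * a) :
    (Fin 2 → CyclicGrp 2) →* X where
  toFun k := a ^ (k 0).toAdd.val * b ^ (k 1).toAdd.val
  map_one' := by simp
  map_mul' k l := by
    have key : ∀ (c : X), c * c = 1 → ∀ i j : ZMod 2, c ^ (i + j).val = c ^ i.val * c ^ j.val := by
      intro c hc i j
      rw [← pow_add, ZMod.val_add, ← pow_eq_pow_mod _ (by rw [pow_two, hc])]
    simp only [Pi.mul_apply, toAdd_mul, key a ha, key b hb]
    simp only [mul_assoc]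
    congr 1
    simp only [← mul_assoc]
    congr 1
    exact Commute.pow_pow hab _ _

/-- The homomorphism from the group of order `2` given by an involution. -/
def involutionHom (a : X) (ha : a * a = 1) : CyclicGrp 2 →* X where
  toFun k := a ^ k.toAdd.val
  map_one' := by simp
  map_mul' k l := by
    rw [← pow_add, toAdd_mul, ZMod.val_add, ← pow_eq_pow_mod _ (by rw [pow_two, ha])]

end GroupTheory

/-! ### The frames and the group -/

/-- The labelled axes spanned by the `15` pairs of vectors of norm `1` in the quadratic space
`𝔽₅³` with form `x² + y² + z²`; for each `i`, the vectors `axis i c` form an orthonormal frame. -/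
def axis (i : Fin 5) (c : ZMod 3) (j : Fin 3) : ZMod 5 :=
  if i = 0 then (if (j.val : ZMod 3) = c then 1 else 0)
  else (![![1, 1, 1], ![1, 1, 1], ![1, -1, -1], ![-1, 1, -1], ![-1, -1, 1]] : Fin 5 → Fin 3 → ZMod 5)
    -- The norm is `1 + 1 + 4 = 1`. The sign in `-c` orients these frames compatibly with frame `0`;
    -- with `c`, the matrix of `rotFive` would reverse the cyclic order.
    i j * (if (j.val : ZMod 3) = -c then 2 else 1)

/-- Reduction modulo `5`. -/
abbrev redFive : ZMod 25 →+* ZMod 5 := ZMod.castHom (show 5 ∣ 25 by norm_num) (ZMod 5)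

/-- Reduction modulo `3`. -/
abbrev redThree : ZMod 9 →+* ZMod 3 := ZMod.castHom (show 3 ∣ 9 by norm_num) (ZMod 3)

/-- The wreath product of `C₉` with `A₅`, times `SL₃(ℤ/25)`. -/
abbrev Ambient : Type :=
  ((Fin 5 → CyclicGrp 9) ⋊[mulAutArrow] alternatingGroup (Fin 5)) ×
    SpecialLinearGroup (Fin 3) (ZMod 25)

namespace Ambient

/-- The underlying permutation. -/
def perm (h : Ambient) : Perm (Fin 5) := h.1.right

/-- The coordinates in `ℤ/9`. -/
def coord (h : Ambient) (i : Fin 5) : ZMod 9 := (h.1.left i).toAdd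

/-- The underlying matrix. -/
def mat (h : Ambient) : Matrix (Fin 3) (Fin 3) (ZMod 25) := h.2

/-- The underlying matrix modulo `5`. -/
def redMat (h : Ambient) : Matrix (Fin 3) (Fin 3) (ZMod 5) := h.mat.map redFive

theorem ext' {h h' : Ambient} (h₁ : h.perm = h'.perm) (h₂ : ∀ i, h.coord i = h'.coord i)
    (h₃ : h.mat = h'.mat) : h = h' := by
  refine Prod.ext (SemidirectProduct.ext ?_ (Subtype.ext h₁)) (Subtype.ext h₃)
  funext i
  exact Multiplicative.toAdd.injective (h₂ i)

@[simp] theorem perm_one : (1 : Ambient).perm = 1 := rfl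
@[simp] theorem perm_mul (h h' : Ambient) : (h * h').perm = h.perm * h'.perm := rfl
@[simp] theorem perm_inv (h : Ambient) : h⁻¹.perm = h.perm⁻¹ := rfl
@[simp] theorem mat_one : (1 : Ambient).mat = 1 := rfl
@[simp] theorem mat_mul (h h' : Ambient) : (h * h').mat = h.mat * h'.mat := rfl
theorem mat_mul_inv (h : Ambient) : h.mat * h⁻¹.mat = 1 := by
  rw [← mat_mul, mul_inv_cancel, mat_one]
@[simp] theorem redMat_one : (1 : Ambient).redMat = 1 := by
  rw [redMat, mat_one, Matrix.map_one _ (map_zero _) (map_one _)]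
@[simp] theorem redMat_mul (h h' : Ambient) : (h * h').redMat = h.redMat * h'.redMat := by
  rw [redMat, mat_mul, Matrix.map_mul]
  rfl
@[simp] theorem coord_one (i : Fin 5) : (1 : Ambient).coord i = 0 := rfl
@[simp] theorem coord_mul (h h' : Ambient) (i : Fin 5) :
    (h * h').coord i = h.coord i + h'.coord (h.perm⁻¹ i) := rfl
@[simp] theorem coord_inv (h : Ambient) (i : Fin 5) :
    h⁻¹.coord i = -h.coord (h.perm i) := by
  have := coord_mul h h⁻¹ (h.perm i)
  rw [mul_inv_cancel, coord_one, ← Perm.mul_apply, inv_mul_cancel, Perm.one_apply] at this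
  exact eq_neg_of_add_eq_zero_right this.symm

end Ambient

/-- The orthogonal matrices over `ℤ/25` that preserve the labelling of the axes up to rotations of
the frames, together with lifts to `ℤ/9` of the rotation amounts, of total sum `0`. -/
def bigGroup : Subgroup Ambient where
  -- The rotation amount is indexed by the target frame, in agreement with the multiplication law
  -- `Ambient.coord_mul`.
  carrier := {h | h.matᵀ * h.mat = 1 ∧ ∑ i, h.coord i = 0 ∧
    ∀ i c, ∃ s : ℤˣ, h.redMat *ᵥ axis i c =
      s • axis (h.perm i) (c + redThree (h.coord (h.perm i)))}
  one_mem' := ⟨by simp, by simp, fun i c => ⟨1, by simp⟩⟩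
  mul_mem' := by
    rintro h h' ⟨h₁, h₂, h₃⟩ ⟨h₁', h₂', h₃'⟩
    refine ⟨?_, ?_, fun i c => ?_⟩
    · rw [Ambient.mat_mul, transpose_mul, Matrix.mul_assoc, ← Matrix.mul_assoc h.matᵀ, h₁,
        Matrix.one_mul, h₁']
    · simp only [Ambient.coord_mul, Finset.sum_add_distrib, h₂, zero_add]
      rw [Equiv.sum_comp h.perm⁻¹ h'.coord, h₂']
    · obtain ⟨s, hs⟩ := h₃' i c
      obtain ⟨t, ht⟩ := h₃ (h'.perm i) (c + redThree (h'.coord (h'.perm i)))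
      refine ⟨s * t, ?_⟩
      rw [Ambient.redMat_mul, ← mulVec_mulVec, hs, mulVec_smul, ht,
        smul_smul]
      have : h.perm⁻¹ (h.perm (h'.perm i)) = h'.perm i := by
        rw [← Perm.mul_apply, inv_mul_cancel, Perm.one_apply]
      simp only [Ambient.perm_mul, Perm.mul_apply, Ambient.coord_mul, this, map_add]
      rw [add_assoc c, add_comm (redThree (h'.coord _))]
  inv_mem' := by
    rintro h ⟨h₁, h₂, h₃⟩
    have hinv : h⁻¹.mat = h.matᵀ := by
      rw [← Matrix.one_mul h⁻¹.mat, ← h₁, Matrix.mul_assoc, h.mat_mul_inv, Matrix.mul_one]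
    refine ⟨?_, ?_, fun i c => ?_⟩
    · rw [hinv, transpose_transpose]
      exact mul_eq_one_comm.1 h₁
    · simp only [Ambient.coord_inv, Finset.sum_neg_distrib]
      rw [Equiv.sum_comp h.perm h.coord, h₂, neg_zero]
    · obtain ⟨s, hs⟩ := h₃ (h.perm⁻¹ i) (c - redThree (h.coord i))
      rw [← Perm.mul_apply, mul_inv_cancel, Perm.one_apply, sub_add_cancel] at hs
      refine ⟨s, ?_⟩
      have : axis i c = s • h.redMat *ᵥ axis (h.perm⁻¹ i) (c - redThree (h.coord i)) := by
        rw [hs, smul_smul, Int.units_mul_self, one_smul]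
      rw [this, mulVec_smul, mulVec_mulVec, ← Ambient.redMat_mul, inv_mul_cancel,
        Ambient.redMat_one, one_mulVec]
      simp [sub_eq_add_neg]

namespace bigGroup

theorem transpose_mul_self (h : bigGroup) : h.1.matᵀ * h.1.mat = 1 := h.2.1

theorem sum_coord (h : bigGroup) : ∑ i, h.1.coord i = 0 := h.2.2.1

theorem exists_mulVec_axis (h : bigGroup) (i : Fin 5) (c : ZMod 3) :
    ∃ s : ℤˣ, h.1.redMat *ᵥ axis i c =
      s • axis (h.1.perm i) (c + redThree (h.1.coord (h.1.perm i))) := h.2.2.2 i c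

/-- The projection to `A₅`. -/
def proj : bigGroup →* alternatingGroup (Fin 5) :=
  (SemidirectProduct.rightHom.comp (MonoidHom.fst _ _)).comp bigGroup.subtype

theorem coe_proj (h : bigGroup) : (proj h : Perm (Fin 5)) = h.1.perm := rfl

theorem proj_eq_one_iff {h : bigGroup} : proj h = 1 ↔ h.1.perm = 1 := by
  rw [← coe_proj, Subtype.ext_iff]
  rfl

theorem mat_inv (h : bigGroup) : (h⁻¹).1.mat = h.1.matᵀ := by
  rw [← Matrix.one_mul (h⁻¹).1.mat, ← transpose_mul_self h, Matrix.mul_assoc, Subgroup.coe_inv,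
    h.1.mat_mul_inv, Matrix.mul_one]

end bigGroup

/-! ### The axes -/

/-- Since the fifteen lines are distinct, a matrix modulo 5 determines the permutation of the frames
and the rotations modulo 3. -/
theorem axis_injective_apply : ∀ (i j : Fin 5) (c d : ZMod 3) (s : ℤˣ),
    (∀ k, axis i c k = s • axis j d k) → i = j ∧ c = d := by
  decide +kernel

theorem axis_injective {i j : Fin 5} {c d : ZMod 3} {s : ℤˣ} (h : axis i c = s • axis j d) :
    i = j ∧ c = d :=
  axis_injective_apply i j c d s (congrFun h)

theorem axis_orthonormal : ∀ (i : Fin 5) (j k : Fin 3),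
    ∑ c : ZMod 3, axis i c j * axis i c k = if j = k then 1 else 0 := by
  decide +kernel

theorem mulVec_axis_ext {M M' : Matrix (Fin 3) (Fin 3) (ZMod 5)} (i : Fin 5)
    (h : ∀ c, M *ᵥ axis i c = M' *ᵥ axis i c) : M = M' := by
  let B : Matrix (Fin 3) (ZMod 3) (ZMod 5) := Matrix.of fun j c => axis i c j
  have hB : B * Bᵀ = (1 : Matrix (Fin 3) (Fin 3) (ZMod 5)) := by
    ext j k
    exact (axis_orthonormal i j k).trans (Matrix.one_apply).symm
  have hMB : M * B = M' * B := by
    ext j c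
    exact congrFun (h c) j
  calc M = M * B * Bᵀ := by rw [Matrix.mul_assoc, hB, Matrix.mul_one]
    _ = M' := by rw [hMB, Matrix.mul_assoc, hB, Matrix.mul_one]

/-- The signed cyclic permutation matrices. -/
def monomial (k : ZMod 3) (s : ZMod 3 → ℤˣ) : Matrix (Fin 3) (Fin 3) (ZMod 5) :=
  Matrix.of fun j c => s c.val • axis 0 (c.val + k) j

theorem monomial_mulVec_axis : ∀ (k : ZMod 3) (s : ZMod 3 → ℤˣ) (c : ZMod 3),
    monomial k s *ᵥ axis 0 c = s c • axis 0 (c + k) := by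
  decide +kernel

/-- A signed cyclic permutation matrix of determinant `1` that permutes the axes of each frame
cyclically is trivial. -/
theorem monomial_eq_one : ∀ (k : ZMod 3) (s : ZMod 3 → ℤˣ), (monomial k s).det = 1 →
    (∀ i : Fin 5, ∃ k' : ZMod 3, ∀ c : ZMod 3, ∃ e : ℤˣ,
      monomial k s *ᵥ axis i c = e • axis i (c + k')) →
    monomial k s = 1 := by
  decide +kernel

/-! ### The kernel of the projection -/

/-- Multiplication by `3` as an embedding of `ℤ/3` into `ℤ/9`. -/
def mulThree : ZMod 3 →+ ZMod 9 :=
  AddMonoidHom.mk' (fun a => 3 * (a.val : ZMod 9)) (by decide +kernel)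

/-- Multiplication by `5` as an embedding of `ℤ/5` into `ℤ/25`. -/
def mulFive : ZMod 5 →+ ZMod 25 :=
  AddMonoidHom.mk' (fun a => 5 * (a.val : ZMod 25)) (by decide +kernel)

theorem mulThree_injective : Function.Injective mulThree := by
  have : ∀ a b, mulThree a = mulThree b → a = b := by decide +kernel
  exact this

theorem mulFive_injective : Function.Injective mulFive := by
  have : ∀ a b, mulFive a = mulFive b → a = b := by decide +kernel
  exact this

theorem mulFive_mul_mulFive : ∀ a b, mulFive a * mulFive b = 0 := by decide +kernel

theorem mulFive_mul : ∀ a t, mulFive a * t = mulFive (a * redFive t) := by decide +kernel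

theorem redThree_mulThree : ∀ a, redThree (mulThree a) = 0 := by decide +kernel

theorem redFive_mulFive : ∀ a, redFive (mulFive a) = 0 := by decide +kernel

theorem exists_mulThree : ∀ t, redThree t = 0 → ∃ a, t = mulThree a := by decide +kernel

theorem exists_mulFive : ∀ t, redFive t = 0 → ∃ a, t = mulFive a := by decide +kernel

/-- This excludes order 3 outside the kernel: a nontrivial rotation lifts to a unit of `ℤ/9`, whose
triple is nonzero. -/
theorem redThree_eq_zero : ∀ t : ZMod 9, t + t + t = 0 → redThree t = 0 := by decide +kernel

/-- The polynomial has discriminant 5 and is `(s - 2)²` modulo 5. Its value is a unit unless `s ≡ 2`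
modulo 5, and then it equals `5` in `ℤ/25`; it is never zero. -/
theorem redFive_eq_zero : ∀ s t : ZMod 25, (s ^ 2 + s - 1) * t = 0 → redFive t = 0 := by
  decide +kernel

theorem two_mul_mulFive_eq_zero : ∀ a, mulFive a + mulFive a = 0 → a = 0 := by decide +kernel

/-- Coordinates of vectors of sum `0` in `𝔽₃⁵`, such that the value of the functional
`y₁ + y₂ - y₃ - y₄` is the first parameter. -/
def sumZero (z : Fin 4 → ZMod 3) : Fin 5 → ZMod 3 :=
  ![z 1 + z 2 + z 0, z 1, z 2, z 3, z 1 + z 2 - z 3 - z 0]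

/-- The skew-symmetric matrix with given entries above the diagonal. -/
def skew {R : Type*} [Ring R] (a : Fin 3 → R) : Matrix (Fin 3) (Fin 3) R :=
  !![0, a 1, a 2; -a 1, 0, a 0; -a 2, -a 0, 0]

theorem det_one_add_skew (a : Fin 3 → ZMod 5) : (1 + skew fun i => mulFive (a i)).det = 1 := by
  have h := mulFive_mul_mulFive
  simp only [skew, det_fin_three, Matrix.add_apply, one_apply, of_apply]
  simp
  linear_combination h (a 0) (a 0) + h (a 1) (a 1) + h (a 2) (a 2)

/-- Products of two multiples of 5 vanish modulo 25, so these matrices multiply by adding their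
parameters. -/
theorem one_add_skew_mul (a b : Fin 3 → ZMod 5) :
    (1 + skew fun i => mulFive (a i)) * (1 + skew fun i => mulFive (b i)) =
      1 + skew fun i => mulFive (a i + b i) := by
  have h : (skew fun i => mulFive (a i)) * (skew fun i => mulFive (b i)) = 0 := by
    have h := mulFive_mul_mulFive
    ext i j
    fin_cases i <;> fin_cases j <;> simp [skew, mul_apply, Fin.sum_univ_three, h]
  have h' : (skew fun i => mulFive (a i + b i)) =
      (skew fun i => mulFive (a i)) + skew fun i => mulFive (b i) := by
    ext i j
    fin_cases i <;> fin_cases j <;> simp [skew] <;> ring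
  rw [h', Matrix.add_mul, Matrix.mul_add, Matrix.mul_add, h]
  simp [add_comm, add_left_comm]

theorem transpose_one_add_skew_mul (a : Fin 3 → ZMod 5) :
    (1 + skew fun i => mulFive (a i))ᵀ * (1 + skew fun i => mulFive (a i)) = 1 := by
  have h' : (1 + skew fun i => mulFive (a i))ᵀ = 1 + skew fun i => mulFive (-a i) := by
    ext i j
    fin_cases i <;> fin_cases j <;> simp [skew]
  have h0 : skew (fun _ : Fin 3 => (0 : ZMod 25)) = 0 := by
    ext i j
    fin_cases i <;> fin_cases j <;> simp [skew]
  rw [h', one_add_skew_mul]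
  simp [h0]

theorem redFive_one_add_skew (a : Fin 3 → ZMod 5) :
    (1 + skew fun i => mulFive (a i)).map redFive = 1 := by
  have h := redFive_mulFive
  ext i j
  rw [map_apply, Matrix.add_apply, map_add]
  fin_cases i <;> fin_cases j <;> simp [skew, h, -ZMod.castHom_apply]

theorem sum_sumZero (z : Fin 4 → ZMod 3) : ∑ i, sumZero z i = 0 := by
  have h : (3 : ZMod 3) = 0 := rfl
  simp only [Fin.sum_univ_five, sumZero]
  simp
  linear_combination (z 1 + z 2) * h

theorem sumZero_add (z w : Fin 4 → ZMod 3) (i : Fin 5) :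
    sumZero (z + w) i = sumZero z i + sumZero w i := by
  fin_cases i <;> simp [sumZero] <;> ring

theorem sumZero_injective {z w : Fin 4 → ZMod 3} (h : ∀ i, sumZero z i = sumZero w i) : z = w := by
  have h0 := h 0
  have h1 : z 1 = w 1 := h 1
  have h2 : z 2 = w 2 := h 2
  have h3 : z 3 = w 3 := h 3
  have h0' : z 0 = w 0 := by
    simpa [sumZero, h1, h2] using h0
  funext i
  fin_cases i <;> assumption

theorem exists_sumZero {y : Fin 5 → ZMod 3} (h : ∑ i, y i = 0) : ∃ z, y = sumZero z := by
  rw [Fin.sum_univ_five] at h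
  have h3 : (3 : ZMod 3) = 0 := rfl
  refine ⟨![y 1 + y 2 - y 3 - y 4, y 1, y 2, y 3], ?_⟩
  funext i
  fin_cases i <;> simp [sumZero]
  linear_combination h - (y 1 + y 2) * h3

theorem sumZero_functional (z : Fin 4 → ZMod 3) :
    sumZero z 1 + sumZero z 2 - sumZero z 3 - sumZero z 4 = z 0 := by
  simp [sumZero]

/-- The group underlying the kernel of the projection to `A₅`. -/
abbrev KernelModel : Type := (Fin 4 → CyclicGrp 3) × (Fin 3 → CyclicGrp 5)

/-- The parameter in `𝔽₃⁴`. -/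
def KernelModel.three (n : KernelModel) : Fin 4 → ZMod 3 := fun i => (n.1 i).toAdd

/-- The parameter in `𝔽₅³`. -/
def KernelModel.five (n : KernelModel) : Fin 3 → ZMod 5 := fun i => (n.2 i).toAdd

theorem KernelModel.ext' {n m : KernelModel} (h₁ : n.three = m.three) (h₂ : n.five = m.five) :
    n = m :=
  Prod.ext h₁ h₂

/-- The embedding of the kernel in the ambient group. -/
def kernelElement (n : KernelModel) : Ambient :=
  (⟨fun i => Multiplicative.ofAdd (mulThree (sumZero n.three i)), 1⟩,
    ⟨1 + skew fun i => mulFive (n.five i), det_one_add_skew _⟩)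

theorem kernelElement_perm (n : KernelModel) : (kernelElement n).perm = 1 := rfl

theorem kernelElement_coord (n : KernelModel) (i : Fin 5) :
    (kernelElement n).coord i = mulThree (sumZero n.three i) := rfl

theorem kernelElement_mat (n : KernelModel) :
    (kernelElement n).mat = 1 + skew fun i => mulFive (n.five i) := rfl

theorem kernelElement_mem (n : KernelModel) : kernelElement n ∈ bigGroup := by
  refine ⟨transpose_one_add_skew_mul _, ?_, fun i c => ⟨1, ?_⟩⟩
  · simp only [kernelElement_coord, ← map_sum, sum_sumZero, map_zero]
  · rw [Ambient.redMat, kernelElement_mat, redFive_one_add_skew, one_mulVec, one_smul,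
      kernelElement_coord, redThree_mulThree, add_zero, kernelElement_perm, Perm.one_apply]

/-- The embedding of the kernel of the projection to `A₅`. -/
def kernelHom : KernelModel →* bigGroup :=
  MonoidHom.mk' (fun n => ⟨kernelElement n, kernelElement_mem n⟩) fun n m => by
    refine Subtype.ext (Ambient.ext' ?_ (fun i => ?_) ?_)
    · simp [kernelElement_perm]
    · rw [Subgroup.coe_mul, Ambient.coord_mul]
      simp only [kernelElement_coord, kernelElement_perm, inv_one, Perm.one_apply, ← map_add,
        ← sumZero_add]
      rfl
    · rw [Subgroup.coe_mul, Ambient.mat_mul]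
      simp only [kernelElement_mat, one_add_skew_mul]
      rfl

theorem coe_kernelHom (n : KernelModel) : (kernelHom n).1 = kernelElement n := rfl

theorem kernelHom_injective : Function.Injective kernelHom := by
  intro n m h
  have h' : kernelElement n = kernelElement m := congrArg Subtype.val h
  refine KernelModel.ext' (sumZero_injective fun i => mulThree_injective ?_) (funext fun i =>
    mulFive_injective ?_)
  · rw [← kernelElement_coord, h', kernelElement_coord]
  · have hm := congrArg Ambient.mat h'
    rw [kernelElement_mat, kernelElement_mat] at hm
    have e : ∀ j k, _ := fun j k =>
      congrFun (congrFun (add_left_cancel (G := Matrix (Fin 3) (Fin 3) (ZMod 25)) hm) j) k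
    fin_cases i
    · exact e 1 2
    · exact e 0 1
    · exact e 0 2

/-- For `g = 1 + 5B` the quadratic term of `gᵀ * g` vanishes, leaving `5(B + Bᵀ) = 0`; the diagonal
is zero because 2 is invertible. -/
theorem exists_skew {g : Matrix (Fin 3) (Fin 3) (ZMod 25)} (hg : gᵀ * g = 1)
    (h : g.map redFive = 1) : ∃ a : Fin 3 → ZMod 5, g = 1 + skew fun i => mulFive (a i) := by
  have h' : ∀ i j, ∃ b, (g - 1) i j = mulFive b := fun i j => by
    refine exists_mulFive _ ?_
    have := congrFun (congrFun h i) j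
    rw [map_apply] at this
    rw [Matrix.sub_apply, map_sub, this]
    fin_cases i <;> fin_cases j <;> simp [-ZMod.castHom_apply]
  choose b hb using h'
  have hgb : g = 1 + Matrix.of fun i j => mulFive (b i j) := by
    ext i j
    rw [Matrix.add_apply, of_apply, ← hb, Matrix.sub_apply, add_sub_cancel]
  have hz : (Matrix.of fun i j => mulFive (b i j))ᵀ * (Matrix.of fun i j => mulFive (b i j)) = 0 := by
    ext i j
    simp [mul_apply, mulFive_mul_mulFive]
  have hs : (Matrix.of fun i j => mulFive (b i j))ᵀ + (Matrix.of fun i j => mulFive (b i j)) = 0 := by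
    rw [hgb, transpose_add, transpose_one, Matrix.add_mul, Matrix.mul_add, Matrix.mul_add, hz,
      Matrix.one_mul, Matrix.one_mul, Matrix.mul_one, add_zero, add_assoc] at hg
    rw [add_comm]
    exact left_eq_add.1 hg.symm
  have hs' : ∀ i j, mulFive (b j i) + mulFive (b i j) = 0 := fun i j => congrFun (congrFun hs i) j
  have hd : ∀ i, b i i = 0 := fun i => two_mul_mulFive_eq_zero _ (hs' i i)
  have ho : ∀ i j, mulFive (b j i) = -mulFive (b i j) := fun i j =>
    eq_neg_of_add_eq_zero_left (hs' i j)
  refine ⟨![b 1 2, b 0 1, b 0 2], ?_⟩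
  rw [hgb]
  congr 1
  ext i j
  fin_cases i <;> fin_cases j <;> simp [skew, hd, ho 0 1, ho 0 2, ho 1 2]

namespace bigGroup

/-- An element with trivial reduction modulo `5` is in the kernel. -/
theorem perm_eq_one_of_redMat_eq_one {h : bigGroup} (hr : h.1.redMat = 1) :
    h.1.perm = 1 ∧ ∀ i, redThree (h.1.coord i) = 0 := by
  have key : ∀ i, h.1.perm i = i ∧ redThree (h.1.coord (h.1.perm i)) = 0 := fun i => by
    obtain ⟨s, hs⟩ := exists_mulVec_axis h i 0
    rw [hr, one_mulVec] at hs
    obtain ⟨h₁, h₂⟩ := axis_injective hs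
    exact ⟨h₁.symm, by simpa using h₂.symm⟩
  refine ⟨Perm.ext fun i => (key i).1, fun i => ?_⟩
  have := (key i).2
  rwa [(key i).1] at this

theorem det_redMat (h : Ambient) : h.redMat.det = 1 := by
  have h1 : h.mat.det = 1 := h.2.2
  have := (redFive.map_det h.mat).symm
  rw [h1, map_one] at this
  exact this

/-- Preserving frame `0` with its cyclic order makes the matrix `monomial`; the other four frames
and the determinant leave only the identity. -/
theorem redMat_eq_one {h : bigGroup} (hp : h.1.perm = 1) : h.1.redMat = 1 := by
  let M := h.1.redMat
  have hM : ∀ i, ∃ k, ∀ c, ∃ s : ℤˣ, M *ᵥ axis i c = s • axis i (c + k) := fun i => by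
    refine ⟨redThree (h.1.coord i), fun c => ?_⟩
    obtain ⟨s, hs⟩ := exists_mulVec_axis h i c
    rw [hp] at hs
    exact ⟨s, hs⟩
  choose k s hs using hM
  have hmon : M = monomial (k 0) (s 0) := mulVec_axis_ext 0 fun c => by
    rw [hs, monomial_mulVec_axis]
  refine hmon.trans (monomial_eq_one _ _ ?_ fun i => ⟨k i, fun c => ⟨s i c, ?_⟩⟩)
  · rw [← hmon, det_redMat]
  · rw [← hmon, hs]

theorem exists_kernelHom {h : bigGroup} (hp : proj h = 1) : ∃ n, h = kernelHom n := by
  rw [proj_eq_one_iff] at hp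
  have hr := redMat_eq_one hp
  obtain ⟨-, hc⟩ := perm_eq_one_of_redMat_eq_one hr
  obtain ⟨a, ha⟩ := exists_skew (transpose_mul_self h) hr
  choose y hy using fun i => exists_mulThree _ (hc i)
  have hsum : ∑ i, y i = 0 := by
    refine mulThree_injective ?_
    rw [map_sum, map_zero, ← sum_coord h]
    exact Finset.sum_congr rfl fun i _ => (hy i).symm
  obtain ⟨z, hz⟩ := exists_sumZero hsum
  refine ⟨(fun i => Multiplicative.ofAdd (z i), fun i => Multiplicative.ofAdd (a i)),
    Subtype.ext (Ambient.ext' hp (fun i => ?_) ha)⟩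
  rw [hy i, hz]
  rfl

theorem proj_kernelHom (n : KernelModel) : proj (kernelHom n) = 1 := rfl

/-! ### Elements of prime order -/

/-- Without rotation in a fixed frame, the matrix only changes signs of a basis. -/
theorem redMat_mul_self_eq_one {h : bigGroup} {i : Fin 5} (hi : h.1.perm i = i)
    (hc : redThree (h.1.coord i) = 0) : h.1.redMat * h.1.redMat = 1 := by
  refine mulVec_axis_ext i fun c => ?_
  obtain ⟨s, hs⟩ := exists_mulVec_axis h i c
  rw [hi, hc, add_zero] at hs
  rw [← mulVec_mulVec, hs, mulVec_smul, hs, smul_smul, Int.units_mul_self, one_smul, one_mulVec]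

/-- As 3 does not divide 5, some frame is fixed. Cubing triples the coordinate there, so that frame
is not rotated and the square is trivial modulo 5. The permutation then has both square and cube
equal to 1. -/
theorem proj_eq_one_of_pow_three {h : bigGroup} (h3 : h ^ 3 = 1) : proj h = 1 := by
  rw [proj_eq_one_iff]
  have h3' : h * h * h = 1 := by rw [← h3, pow_succ, pow_two]
  have hp : h.1.perm ^ 3 = 1 := by
    rw [← coe_proj, ← Subgroup.coe_pow, ← map_pow, h3, map_one, Subgroup.coe_one]
  obtain ⟨i, hi⟩ := Perm.exists_fixed_point_of_prime (p := 3) (n := 1) (by decide)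
    (σ := h.1.perm) (by rw [pow_one, hp])
  have hi' : h.1.perm⁻¹ i = i := Perm.inv_eq_iff_eq.2 hi.symm
  have hc : redThree (h.1.coord i) = 0 := by
    refine redThree_eq_zero _ ?_
    have := congrArg (fun x : bigGroup => x.1.coord i) h3'
    have hs : h.1.perm.symm i = i := hi'
    simpa [_root_.mul_inv_rev, hs] using this
  have h2 : (h * h).1.perm = 1 := by
    refine (perm_eq_one_of_redMat_eq_one ?_).1
    rw [Subgroup.coe_mul, Ambient.redMat_mul, redMat_mul_self_eq_one hi hc]
  rw [Subgroup.coe_mul, Ambient.perm_mul] at h2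
  rwa [pow_succ, pow_two, h2, one_mul] at hp

theorem adjugate_eq_transpose (h : bigGroup) : h.1.mat.adjugate = h.1.matᵀ := by
  have hdet : h.1.mat.det = 1 := h.1.2.2
  have h1 : h.1.mat * h.1.mat.adjugate = 1 := by rw [mul_adjugate, hdet, one_smul]
  rw [← Matrix.one_mul h.1.mat.adjugate, ← transpose_mul_self h, Matrix.mul_assoc, h1,
    Matrix.mul_one]

end bigGroup

/-- The Cayley-Hamilton theorem for a matrix of size `3` whose inverse is its transpose. -/
theorem pow_three_eq_of_adjugate {R : Type*} [CommRing R] {g : Matrix (Fin 3) (Fin 3) R}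
    (hg : g * gᵀ = 1) (h : g.adjugate = gᵀ) :
    g * g * g = g.trace • (g * g) - g.trace • g + 1 := by
  -- The second coefficient of the characteristic polynomial is the trace of the adjugate, here of
  -- `gᵀ`, hence equals `g.trace`.
  have key : g.adjugate = g * g - g.trace • g + g.trace • 1 := by
    have htr : g.trace • (1 : Matrix (Fin 3) (Fin 3) R) = g.adjugate.trace • 1 := by
      rw [h, trace_transpose]
    rw [htr]
    ext i j
    fin_cases i <;> fin_cases j <;>
      simp [adjugate_fin_three, mul_apply, Fin.sum_univ_three, trace] <;> ring
  have h1 := hg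
  rw [← h, key, Matrix.mul_add, Matrix.mul_sub, Matrix.mul_smul, Matrix.mul_smul, Matrix.mul_one,
    ← Matrix.mul_assoc] at h1
  rw [← h1]
  abel

namespace bigGroup

/-- The characteristic polynomial is `(X - 1)(X² - sX + 1)` with `s = t - 1`. Combined with `g ^ 5 =
1` it yields `(s² + s - 1)(g - 1) = 0`, so `g ≡ 1` modulo 5 by `redFive_eq_zero`. -/
theorem proj_eq_one_of_pow_five {h : bigGroup} (h5 : h ^ 5 = 1) : proj h = 1 := by
  rw [proj_eq_one_iff]
  refine (perm_eq_one_of_redMat_eq_one ?_).1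
  set g := h.1.mat with hgdef
  have hch : g * g * g = g.trace • (g * g) - g.trace • g + 1 :=
    pow_three_eq_of_adjugate (mul_eq_one_comm.1 (transpose_mul_self h)) (adjugate_eq_transpose h)
  have hg5 : g * g * g * g * g = 1 := by
    have : h * h * h * h * h = 1 := by rw [← h5]; simp only [pow_succ, pow_zero, one_mul]
    exact congrArg (fun x : bigGroup => x.1.mat) this
  set t := g.trace
  have h4 : g * g * g * g = t • (g * g * g) - t • (g * g) + g := by
    rw [hch, Matrix.add_mul, Matrix.sub_mul, Matrix.smul_mul, Matrix.smul_mul, Matrix.one_mul, ← hch]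
  have h5' : g * g * g * g * g = t • (g * g * g * g) - t • (g * g * g) + g * g := by
    rw [h4, Matrix.add_mul, Matrix.sub_mul, Matrix.smul_mul, Matrix.smul_mul]
    simp only [← h4]
  have h6 : g = t • (g * g * g * g * g) - t • (g * g * g * g) + g * g * g := by
    have := congrArg (· * g) h5'
    simp only [Matrix.add_mul, Matrix.sub_mul, Matrix.smul_mul] at this
    rwa [hg5, Matrix.one_mul, ← hg5] at this
  have h7 : g * g = t • g - t • (g * g * g * g * g) + g * g * g * g := by
    have := congrArg (· * g) h6
    simp only [Matrix.add_mul, Matrix.sub_mul, Matrix.smul_mul] at this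
    rwa [hg5, Matrix.one_mul, ← hg5] at this
  have key : ∀ i j, redFive ((g - 1) i j) = 0 := fun i j => by
    refine redFive_eq_zero (t - 1) _ ?_
    have e3 := congrFun (congrFun hch i) j
    have e6 := congrFun (congrFun h6 i) j
    have e7 := congrFun (congrFun h7 i) j
    rw [hg5] at e6 e7
    simp only [Matrix.add_apply, Matrix.sub_apply, Matrix.smul_apply, smul_eq_mul] at e3 e6 e7 ⊢
    linear_combination -e3 - e6 - t * e7
  ext i j
  have := key i j
  rw [Matrix.sub_apply, map_sub, sub_eq_zero] at this
  rw [Ambient.redMat, map_apply, this]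
  fin_cases i <;> fin_cases j <;> simp [-ZMod.castHom_apply]

/-! ### Some elements -/

/-- An element of order `5` in `A₅`, lifted. -/
def rotFive : bigGroup :=
  -- The matrix forces these entries modulo 3; their lifts are chosen with sum 9.
  ⟨(⟨fun i => Multiplicative.ofAdd ((![2, 1, 2, 0, 4] : Fin 5 → ZMod 9) i),
      ⟨⟨![1, 2, 3, 4, 0], ![4, 0, 1, 2, 3], by decide, by decide⟩,
        Perm.mem_alternatingGroup.2 (by decide +kernel)⟩⟩,
    ⟨!![9, 9, -8; 9, 8, -9; 8, 9, -9], by decide +kernel⟩),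
    by decide +kernel, by decide +kernel, by decide +kernel⟩

/-- An element of order `3` in `A₅`, lifted. -/
def rotThree : bigGroup :=
  ⟨(⟨fun i => Multiplicative.ofAdd ((![1, -1, -1, -1, 2] : Fin 5 → ZMod 9) i),
      ⟨⟨![0, 1, 3, 4, 2], ![0, 1, 4, 2, 3], by decide, by decide⟩,
        Perm.mem_alternatingGroup.2 (by decide +kernel)⟩⟩,
    ⟨!![0, 0, 1; 1, 0, 0; 0, 1, 0], by decide +kernel⟩),
    by decide +kernel, by decide +kernel, by decide +kernel⟩

/-- The first generator of a Klein four-group. -/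
def kleinA : bigGroup :=
  ⟨(⟨1, ⟨⟨![0, 2, 1, 4, 3], ![0, 2, 1, 4, 3], by decide, by decide⟩,
        Perm.mem_alternatingGroup.2 (by decide +kernel)⟩⟩,
    ⟨!![1, 0, 0; 0, -1, 0; 0, 0, -1], by decide +kernel⟩),
    by decide +kernel, by decide +kernel, by decide +kernel⟩

/-- The second generator of a Klein four-group. -/
def kleinB : bigGroup :=
  ⟨(⟨1, ⟨⟨![0, 3, 4, 1, 2], ![0, 3, 4, 1, 2], by decide, by decide⟩,
        Perm.mem_alternatingGroup.2 (by decide +kernel)⟩⟩,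
    ⟨!![-1, 0, 0; 0, 1, 0; 0, 0, -1], by decide +kernel⟩),
    by decide +kernel, by decide +kernel, by decide +kernel⟩

theorem kleinA_mul_self : kleinA * kleinA = 1 :=
  Subtype.ext (Ambient.ext' (by decide +kernel) (by decide +kernel) (by decide +kernel))

theorem kleinB_mul_self : kleinB * kleinB = 1 :=
  Subtype.ext (Ambient.ext' (by decide +kernel) (by decide +kernel) (by decide +kernel))

theorem kleinA_mul_kleinB : kleinA * kleinB = kleinB * kleinA :=
  Subtype.ext (Ambient.ext' (by decide +kernel) (by decide +kernel) (by decide +kernel))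

/-- A transversal of the stabilizer of the first axis in `A₅`, lifted. -/
def mover (i : Fin 5) (k : Fin 3) : bigGroup := rotFive ^ (i : ℕ) * rotThree ^ (k : ℕ)

/-- Transitivity on the fifteen axes: the movers carry the axis with labels `0`, `0` to every other.
-/
theorem exists_mover_perm_eq (i : Fin 5) (c : ZMod 3) : ∃ j k, (mover j k).1.perm 0 = i ∧
    redThree ((mover j k).1.coord i) = c := by
  revert i c
  decide +kernel

/-- The functional `y₁ + y₂ - y₃ - y₄`, after a permutation of the coordinates. -/
def functional (σ : Perm (Fin 5)) (z : Fin 4 → ZMod 3) : ZMod 3 :=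
  sumZero z (σ 1) + sumZero z (σ 2) - sumZero z (σ 3) - sumZero z (σ 4)

/-- The conjugate hyperplanes cover `𝔽₃⁴`, which puts elements of order 3 into point stabilizers;
that they meet only in zero, checked next, serves core-freeness. -/
theorem exists_functional_eq_zero :
    ∀ z, ∃ j k, functional (mover j k).1.perm z = 0 := by
  decide +kernel

theorem eq_zero_of_functional_eq_zero :
    ∀ z, (∀ j k, functional (mover j k).1.perm z = 0) → ∀ i, z i = 0 := by
  decide +kernel

/-- The value of a skew-symmetric matrix at two vectors, in terms of their vector product. -/
def pairing (a v : Fin 3 → ZMod 5) : ZMod 5 := a 0 * v 0 - a 2 * v 1 + a 1 * v 2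

/-- The counterpart for order 5: every vector of `𝔽₅³` is orthogonal to some norm-one vector. -/
theorem exists_pairing_eq_zero : ∀ a, ∃ i c, pairing a (axis i c) = 0 := by
  decide +kernel

theorem eq_zero_of_pairing_eq_zero : ∀ a, (∀ i c, pairing a (axis i c) = 0) → ∀ i, a i = 0 := by
  decide +kernel

/-! ### Conjugation on the kernel -/

/-- The entry is the skew form at the last two columns of `h.1.mat`, which depends only on their
vector product. That product is the first column, since the adjugate is the transpose. -/
theorem conj_one_add_skew_apply {h : bigGroup} (a : Fin 3 → ZMod 5) :
    (h.1.matᵀ * (1 + skew fun i => mulFive (a i)) * h.1.mat) 1 2 =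
      mulFive (pairing a fun j => h.1.redMat j 0) := by
  have hr : ∀ j, redFive (h.1.mat j 0) = h.1.redMat j 0 := fun j => rfl
  have hadj := adjugate_eq_transpose h
  have e : ∀ j, h.1.mat j 0 = h.1.mat.adjugate 0 j := fun j => by rw [hadj, transpose_apply]
  rw [Matrix.mul_add, Matrix.mul_one, Matrix.add_mul, transpose_mul_self, Matrix.add_apply,
    one_apply_ne (by decide), zero_add]
  simp only [pairing, map_add, map_sub, ← hr, ← mulFive_mul]
  rw [e 0, e 1, e 2, adjugate_fin_three]
  simp [skew, mul_apply, Fin.sum_univ_three]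
  ring

/-- The parameters at `0` cut out the stabilizer's part of the kernel. After conjugation they
depend, up to sign, only on the permutation and the image of the first axis, which reduces covering
and core-freeness to the finite checks above. -/
theorem conj_kernelHom (h : bigGroup) (n : KernelModel) :
    ∃ m, h⁻¹ * kernelHom n * h = kernelHom m ∧ m.three 0 = functional h.1.perm n.three ∧
      ∃ s : ℤˣ, m.five 0 =
        s • pairing n.five (axis (h.1.perm 0) (redThree (h.1.coord (h.1.perm 0)))) := by
  obtain ⟨m, hm⟩ := exists_kernelHom (h := h⁻¹ * kernelHom n * h) (by
    rw [map_mul, map_mul, proj_kernelHom, mul_one, ← map_mul, inv_mul_cancel, map_one])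
  refine ⟨m, hm, ?_, ?_⟩
  · have hc : ∀ i, sumZero m.three i = sumZero n.three (h.1.perm i) := fun i => by
      refine mulThree_injective ?_
      rw [← kernelElement_coord, ← coe_kernelHom, ← hm]
      have hs : h.1.perm.symm (h.1.perm i) = i := h.1.perm.symm_apply_apply i
      simp [coe_kernelHom, kernelElement_coord, kernelElement_perm]
    rw [← sumZero_functional m.three, functional, hc, hc, hc, hc]
  · obtain ⟨s, hs⟩ := exists_mulVec_axis h 0 0
    refine ⟨s, mulFive_injective ?_⟩
    have h12 : mulFive (m.five 0) = (kernelHom m).1.mat 1 2 := by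
      rw [coe_kernelHom, kernelElement_mat]
      simp [skew]
    rw [h12, ← hm, Subgroup.coe_mul, Ambient.mat_mul, Subgroup.coe_mul, Ambient.mat_mul, mat_inv,
      coe_kernelHom, kernelElement_mat, conj_one_add_skew_apply]
    congr 1
    have hv : (fun j => h.1.redMat j 0) =
        s • axis (h.1.perm 0) (redThree (h.1.coord (h.1.perm 0))) := by
      rw [zero_add] at hs
      rw [← hs]
      funext j
      have : axis 0 0 = Pi.single 0 1 := by decide +kernel
      rw [this, mulVec_single_one]
      rfl
    rw [hv]
    rcases Int.units_eq_one_or s with rfl | rfl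
    · simp
    · simp [pairing]
      ring

/-! ### The subgroup of the kernel -/

/-- The group underlying the intersection of the kernel with a point stabilizer. -/
abbrev StabModel : Type := (Fin 3 → CyclicGrp 3) × (Fin 2 → CyclicGrp 5)

/-- The embedding of the intersection of the kernel with a point stabilizer in the kernel. -/
def stabIncl : StabModel →* KernelModel where
  toFun u := (Fin.cons 1 u.1, Fin.cons 1 u.2)
  map_one' := by
    refine Prod.ext (funext fun i => ?_) (funext fun i => ?_) <;>
      refine Fin.cases ?_ (fun j => ?_) i <;> rfl
  map_mul' u v := by
    refine Prod.ext (funext fun i => ?_) (funext fun i => ?_) <;>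
      refine Fin.cases ?_ (fun j => ?_) i <;> rfl

/-- The embedding of the intersection of the kernel with a point stabilizer. -/
def stabHom : StabModel →* bigGroup := kernelHom.comp stabIncl

theorem stabHom_injective : Function.Injective stabHom := by
  refine kernelHom_injective.comp fun u v h => ?_
  have h₁ : ∀ i, (stabIncl u).1 i = (stabIncl v).1 i := fun i => by rw [h]
  have h₂ : ∀ i, (stabIncl u).2 i = (stabIncl v).2 i := fun i => by rw [h]
  exact Prod.ext (funext fun i => h₁ i.succ) (funext fun i => h₂ i.succ)

theorem proj_stabHom (u : StabModel) : proj (stabHom u) = 1 := rfl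

theorem kernelHom_mem_range_stabHom {n : KernelModel} :
    kernelHom n ∈ stabHom.range ↔ n.three 0 = 0 ∧ n.five 0 = 0 := by
  constructor
  · rintro ⟨u, hu⟩
    rw [← kernelHom_injective hu]
    exact ⟨rfl, rfl⟩
  · rintro ⟨h₁, h₂⟩
    refine ⟨(Fin.tail n.1, Fin.tail n.2), congrArg kernelHom (KernelModel.ext' ?_ ?_)⟩
    · funext i
      refine Fin.cases h₁.symm (fun j => rfl) i
    · funext i
      refine Fin.cases h₂.symm (fun j => rfl) i

/-- Both hyperplanes are preserved: the first by assumption, the second because the first axis is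
fixed up to sign. For an involution one inclusion suffices. -/
theorem mem_normalizer_of_mul_self_eq_one {t : bigGroup} (ht : t * t = 1)
    (h : ∀ n : KernelModel, n.three 0 = 0 → functional t.1.perm n.three = 0)
    (h0 : t.1.perm 0 = 0) (hc : t.1.coord 0 = 0) :
    t ∈ Subgroup.normalizer (stabHom.range : Set bigGroup) := by
  have ht' : t⁻¹ = t := inv_eq_of_mul_eq_one_left ht
  have key : ∀ x ∈ stabHom.range, t⁻¹ * x * t ∈ stabHom.range := by
    rintro _ ⟨u, rfl⟩
    have hu : stabHom u ∈ stabHom.range := ⟨u, rfl⟩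
    rw [stabHom, MonoidHom.comp_apply, ← stabHom] at hu ⊢
    obtain ⟨m, hm, h₁, s, h₂⟩ := conj_kernelHom t (stabIncl u)
    obtain ⟨h₃, h₄⟩ := kernelHom_mem_range_stabHom.1 hu
    rw [hm, kernelHom_mem_range_stabHom]
    refine ⟨h₁.trans (h _ h₃), h₂.trans ?_⟩
    rw [h0, hc, map_zero]
    have e : ∀ a : Fin 3 → ZMod 5, pairing a (axis 0 0) = a 0 := fun a => by
      have : axis 0 0 = Pi.single 0 1 := by decide +kernel
      simp [pairing, this]
    rw [e, h₄, smul_zero]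
  rw [Subgroup.mem_normalizer_iff]
  intro x
  refine ⟨fun hx => ?_, fun hx => ?_⟩
  · simpa [ht'] using key x hx
  · have := key _ hx
    simp only [ht', mul_assoc, ht, mul_one] at this
    rwa [← mul_assoc, ht, one_mul] at this

theorem kleinA_mem_normalizer : kleinA ∈ Subgroup.normalizer (stabHom.range : Set bigGroup) := by
  refine mem_normalizer_of_mul_self_eq_one kleinA_mul_self (fun n hn => ?_) (by decide +kernel)
    (by decide +kernel)
  have : functional kleinA.1.perm n.three = n.three 0 := by
    rw [← sumZero_functional n.three]
    change sumZero n.three 2 + sumZero n.three 1 - sumZero n.three 4 - sumZero n.three 3 = _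
    ring
  rw [this, hn]

theorem kleinB_mem_normalizer : kleinB ∈ Subgroup.normalizer (stabHom.range : Set bigGroup) := by
  refine mem_normalizer_of_mul_self_eq_one kleinB_mul_self (fun n hn => ?_) (by decide +kernel)
    (by decide +kernel)
  have : functional kleinB.1.perm n.three = - n.three 0 := by
    rw [← sumZero_functional n.three]
    change sumZero n.three 3 + sumZero n.three 4 - sumZero n.three 1 - sumZero n.three 2 = _
    ring
  rw [this, hn, neg_zero]

end bigGroup

/-! ### Products with a normalizing group -/

section

variable {X N K : Type*} [Group X] [Group N] [Group K]

/-- The product of the range of a homomorphism and of a group normalizing it. -/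
theorem exists_subgroup_mem_iff (ι : N →* X) (s : K →* X)
    (hs : ∀ k, s k ∈ Subgroup.normalizer (ι.range : Set X)) :
    ∃ H : Subgroup X, ∀ h, h ∈ H ↔ ∃ u k, h = ι u * s k := by
  have hconj : ∀ k u, ∃ u', s k * ι u = ι u' * s k := fun k u => by
    obtain ⟨u', hu'⟩ := (Subgroup.mem_normalizer_iff.1 (hs k) (ι u)).1 ⟨u, rfl⟩
    exact ⟨u', by rw [hu', inv_mul_cancel_right]⟩
  refine ⟨⟨⟨⟨{h | ∃ u k, h = ι u * s k}, ?_⟩, ⟨1, 1, by simp⟩⟩, ?_⟩, fun h => Iff.rfl⟩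
  · rintro _ _ ⟨u, k, rfl⟩ ⟨v, l, rfl⟩
    obtain ⟨v', hv'⟩ := hconj k v
    refine ⟨u * v', k * l, ?_⟩
    rw [map_mul, map_mul, mul_assoc, ← mul_assoc (s k), hv']
    simp only [mul_assoc]
  · rintro _ ⟨u, k, rfl⟩
    obtain ⟨u', hu'⟩ := hconj k⁻¹ u⁻¹
    refine ⟨u', k⁻¹, ?_⟩
    rw [← hu', map_inv, map_inv, _root_.mul_inv_rev]

end

/-! ### Non-splitness, conjugacy of involutions and elusive coset actions -/

namespace bigGroup

instance : Finite Ambient := by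
  have : Finite ((Fin 5 → CyclicGrp 9) ⋊[mulAutArrow] alternatingGroup (Fin 5)) :=
    Finite.of_equiv _ SemidirectProduct.equivProd.symm
  have : Finite (SpecialLinearGroup (Fin 3) (ZMod 25)) := Subtype.finite
  exact Finite.instProd

theorem natCard_alternatingGroup_five : Nat.card (alternatingGroup (Fin 5)) = 60 := by
  rw [nat_card_alternatingGroup, Nat.card_eq_fintype_card, Fintype.card_fin]
  rfl

theorem proj_rotThree_ne : proj rotThree * proj rotThree ≠ 1 := by
  rw [← map_mul, Ne, proj_eq_one_iff]
  decide +kernel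

theorem orderOf_proj_rotThree : orderOf (proj rotThree) = 3 := by
  refine orderOf_eq_prime ?_ fun h => proj_rotThree_ne (by rw [h, one_mul])
  rw [← map_pow, proj_eq_one_iff]
  decide +kernel

theorem orderOf_proj_rotFive : orderOf (proj rotFive) = 5 := by
  have : Fact (Nat.Prime 5) := ⟨by norm_num⟩
  refine orderOf_eq_prime ?_ fun h => ?_
  · rw [← map_pow, proj_eq_one_iff]
    decide +kernel
  · rw [proj_eq_one_iff] at h
    revert h
    decide +kernel

/-- The Klein four-group in the big group. -/
def kleinHom : (Fin 2 → CyclicGrp 2) →* bigGroup :=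
  kleinFourHom kleinA kleinB kleinA_mul_self kleinB_mul_self kleinA_mul_kleinB

theorem proj_comp_kleinHom_injective : Function.Injective (proj.comp kleinHom) := by
  rw [injective_iff_map_eq_one]
  have : ∀ k : Fin 2 → ZMod 2, (kleinA ^ (k 0).val * kleinB ^ (k 1).val).1.perm = 1 →
      ∀ i, k i = 0 := by
    decide +kernel
  intro k hk
  exact funext fun i => this k (proj_eq_one_iff.1 hk) i

/-- The image has elements of orders 3 and 5 and a Klein four-group, so its order is divisible by
60. -/
theorem proj_surjective : Function.Surjective proj := by
  rw [← MonoidHom.range_eq_top]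
  refine Subgroup.eq_top_of_card_eq _ (Nat.dvd_antisymm (Subgroup.card_subgroup_dvd_card _) ?_)
  rw [natCard_alternatingGroup_five]
  have h3 : 3 ∣ Nat.card proj.range := by
    have := Subgroup.orderOf_dvd_natCard proj.range ⟨rotThree, rfl⟩
    rwa [orderOf_proj_rotThree] at this
  have h5 : 5 ∣ Nat.card proj.range := by
    have := Subgroup.orderOf_dvd_natCard proj.range ⟨rotFive, rfl⟩
    rwa [orderOf_proj_rotFive] at this
  have h4 : 4 ∣ Nat.card proj.range := by
    have h := Subgroup.card_dvd_of_injective (proj.rangeRestrict.comp kleinHom) fun a b hab =>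
      proj_comp_kleinHom_injective (congrArg Subtype.val hab)
    have : Nat.card (Fin 2 → CyclicGrp 2) = 4 := by
      simp [CyclicGrp]
    rwa [this] at h
  omega

/-- The extension of `A₅` by the kernel. -/
def extension : GroupExtension KernelModel bigGroup (alternatingGroup (Fin 5)) where
  inl := kernelHom
  rightHom := proj
  inl_injective := kernelHom_injective
  range_inl_eq_ker_rightHom := by
    ext h
    rw [MonoidHom.mem_range, MonoidHom.mem_ker]
    constructor
    · rintro ⟨n, rfl⟩
      exact proj_kernelHom n
    · intro h1
      obtain ⟨n, hn⟩ := exists_kernelHom h1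
      exact ⟨n, hn.symm⟩
  rightHom_surjective := proj_surjective

/-- A section would lift an element of order 3 of `A₅` to one with trivial cube outside the kernel.
-/
theorem isNonSplitExtensionOf :
    IsNonSplitExtensionOf bigGroup KernelModel (alternatingGroup (Fin 5)) := by
  refine ⟨extension, ⟨fun s => ?_⟩⟩
  have hs : ∀ g, proj (s.toMonoidHom g) = g := s.rightInverse_rightHom
  have h3 : s.toMonoidHom (proj rotThree) ^ 3 = 1 := by
    have := pow_orderOf_eq_one (proj rotThree)
    rw [orderOf_proj_rotThree] at this
    rw [← map_pow, this, map_one]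
  have h1 := proj_eq_one_of_pow_three h3
  rw [hs] at h1
  exact proj_rotThree_ne (by rw [h1, one_mul])

theorem natCard_kernelModel : Nat.card KernelModel = 3 ^ 4 * 5 ^ 3 := by
  simp [CyclicGrp]

theorem natCard_stabModel : Nat.card StabModel = 3 ^ 3 * 5 ^ 2 := by
  simp [CyclicGrp]

theorem natCard_eq : Nat.card bigGroup = 2 ^ 2 * 3 ^ 5 * 5 ^ 4 := by
  have h := proj.ker.card_mul_index
  rw [Subgroup.index_ker, MonoidHom.range_eq_top.2 proj_surjective, Subgroup.card_top,
    natCard_alternatingGroup_five, show proj.ker = kernelHom.range from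
      extension.range_inl_eq_ker_rightHom.symm,
    ← Nat.card_congr (MonoidHom.ofInjective kernelHom_injective).toEquiv,
    natCard_kernelModel] at h
  rw [← h]
  norm_num

theorem kernelHom_pow_fifteen (n : KernelModel) : kernelHom n ^ 15 = 1 := by
  rw [← map_pow]
  have h3 : ∀ t : CyclicGrp 3, t ^ 15 = 1 := by decide +kernel
  have h5 : ∀ t : CyclicGrp 5, t ^ 15 = 1 := by decide +kernel
  have : n ^ 15 = 1 := Prod.ext (funext fun i => h3 _) (funext fun i => h5 _)
  rw [this, map_one]

theorem exists_mover_conj_eq : ∀ σ : Perm (Fin 5), σ * σ = 1 → Perm.sign σ = 1 → σ ≠ 1 →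
    ∃ j k, (mover j k).1.perm⁻¹ * σ * (mover j k).1.perm = kleinA.1.perm := by
  decide +kernel

/-- All involutions of the big group are conjugate. -/
theorem exists_conj_eq_kleinA {h : bigGroup} (h2 : h * h = 1) (h1 : h ≠ 1) :
    ∃ x, x * h * x⁻¹ = kleinA := by
  have hp1 : proj h ≠ 1 := fun hp => by
    obtain ⟨n, rfl⟩ := exists_kernelHom hp
    refine h1 ?_
    have := kernelHom_pow_fifteen n
    rwa [pow_succ, show 14 = 2 * 7 from rfl, pow_mul, pow_two, h2, one_pow, one_mul] at this
  obtain ⟨j, k, hjk⟩ := exists_mover_conj_eq (proj h)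
    (by rw [coe_proj, ← Ambient.perm_mul, ← Subgroup.coe_mul, h2]; rfl)
    (Perm.mem_alternatingGroup.1 (proj h).2) fun hp => hp1 (Subtype.ext hp)
  obtain ⟨y, hy⟩ : ∃ y, y = (mover j k)⁻¹ := ⟨_, rfl⟩
  have hτ : proj y * proj h * (proj y)⁻¹ = proj kleinA := by
    rw [hy, ← map_inv, inv_inv]
    exact Subtype.ext hjk
  have hy2 : (y * h * y⁻¹) * (y * h * y⁻¹) = 1 := by
    rw [conj_mul, h2, mul_one, mul_inv_cancel]
  -- Both involutions now have the same image in `A₅`, so their product lies in the kernel, which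
  -- has exponent 15.
  obtain ⟨n, hn⟩ := exists_kernelHom (h := y * h * y⁻¹ * kleinA) (by
    rw [map_mul, map_mul, map_mul, map_inv, hτ, ← map_mul, kleinA_mul_self, map_one])
  have key := conj_eq_of_mul_pow_fifteen hy2 kleinA_mul_self (by
    rw [hn, kernelHom_pow_fifteen])
  refine ⟨(y * h * y⁻¹ * kleinA) ^ 7 * y, ?_⟩
  refine Eq.trans ?_ key
  simp only [_root_.mul_inv_rev, mul_assoc]

/-- Elements of prime order are conjugate to an element of any subgroup that contains the
involution `kleinA` and the range of `stabHom`. -/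
theorem exists_conj_mem {H : Subgroup bigGroup} (hU : stabHom.range ≤ H) (hA : kleinA ∈ H)
    (h : bigGroup) (hh : (orderOf h).Prime) : ∃ x, x * h * x⁻¹ ∈ H := by
  have hdvd : orderOf h ∣ 2 ^ 2 * 3 ^ 5 * 5 ^ 4 := natCard_eq ▸ orderOf_dvd_natCard h
  have hcases : orderOf h = 2 ∨ orderOf h = 3 ∨ orderOf h = 5 := by
    rcases (Nat.Prime.dvd_mul hh).1 hdvd with h' | h'
    · rcases (Nat.Prime.dvd_mul hh).1 h' with h' | h'
      · exact Or.inl ((Nat.prime_dvd_prime_iff_eq hh Nat.prime_two).1 (hh.dvd_of_dvd_pow h'))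
      · exact Or.inr (Or.inl
          ((Nat.prime_dvd_prime_iff_eq hh Nat.prime_three).1 (hh.dvd_of_dvd_pow h')))
    · exact Or.inr (Or.inr
        ((Nat.prime_dvd_prime_iff_eq hh Nat.prime_five).1 (hh.dvd_of_dvd_pow h')))
  have hpow := pow_orderOf_eq_one h
  rcases hcases with h2 | h3 | h5
  · rw [h2, pow_two] at hpow
    obtain ⟨x, hx⟩ := exists_conj_eq_kleinA hpow fun h1 => by simp [h1] at h2
    exact ⟨x, hx ▸ hA⟩
  · rw [h3] at hpow
    obtain ⟨n, rfl⟩ := exists_kernelHom (proj_eq_one_of_pow_three hpow)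
    rw [← map_pow, map_eq_one_iff _ kernelHom_injective] at hpow
    -- The 5-part is trivial, so only the hyperplane condition in `𝔽₃⁴` has to be met.
    have ht : ∀ t : CyclicGrp 5, t ^ 3 = 1 → t = 1 := by decide +kernel
    have hn : n.five = 0 := funext fun i => ht _ (congrFun (congrArg Prod.snd hpow) i)
    obtain ⟨j, k, hjk⟩ := exists_functional_eq_zero n.three
    obtain ⟨m, hm, h₁, s, h₂⟩ := conj_kernelHom (mover j k) n
    refine ⟨(mover j k)⁻¹, hU ?_⟩
    rw [inv_inv, hm, kernelHom_mem_range_stabHom]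
    exact ⟨h₁.trans hjk, by rw [h₂, hn]; simp [pairing]⟩
  · rw [h5] at hpow
    obtain ⟨n, rfl⟩ := exists_kernelHom (proj_eq_one_of_pow_five hpow)
    rw [← map_pow, map_eq_one_iff _ kernelHom_injective] at hpow
    have ht : ∀ t : CyclicGrp 3, t ^ 5 = 1 → t = 1 := by decide +kernel
    have hn : n.three = 0 := funext fun i => ht _ (congrFun (congrArg Prod.fst hpow) i)
    obtain ⟨i, c, hic⟩ := exists_pairing_eq_zero n.five
    obtain ⟨j, k, rfl, rfl⟩ := exists_mover_perm_eq i c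
    obtain ⟨m, hm, h₁, s, h₂⟩ := conj_kernelHom (mover j k) n
    refine ⟨(mover j k)⁻¹, hU ?_⟩
    rw [inv_inv, hm, kernelHom_mem_range_stabHom]
    refine ⟨h₁.trans ?_, by rw [h₂, hic, smul_zero]⟩
    have h0 : ∀ i, sumZero 0 i = 0 := by decide
    simp only [hn, functional, h0, sub_zero, add_zero]

/-- A subgroup is core-free if its elements in the kernel belong to the range of `stabHom`, and
its image in `A₅` has exponent at most `2`. -/
theorem normalCore_eq_bot {H : Subgroup bigGroup}
    (hU : ∀ h ∈ H, proj h = 1 → h ∈ stabHom.range) (hsq : ∀ h ∈ H, proj h * proj h = 1) :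
    H.normalCore = ⊥ := by
  have hmap : (H.normalCore.map proj).Normal :=
    Subgroup.Normal.map inferInstance _ proj_surjective
  have hproj : ∀ h ∈ H.normalCore, proj h = 1 := by
    -- By simplicity of `A₅` the core has trivial or full image; full is impossible, as `rotThree`
    -- does not square to 1 there.
    rcases hmap.eq_bot_or_eq_top with hb | ht
    · intro h hh
      rw [← Subgroup.mem_bot, ← hb]
      exact ⟨h, hh, rfl⟩
    · obtain ⟨h, hh, hr⟩ := (ht ▸ Subgroup.mem_top (proj rotThree) :
        proj rotThree ∈ H.normalCore.map proj)
      exact absurd (hr ▸ hsq h (H.normalCore_le hh)) proj_rotThree_ne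
  rw [eq_bot_iff]
  intro h hh
  obtain ⟨n, rfl⟩ := exists_kernelHom (hproj h hh)
  have hconj : ∀ x, x⁻¹ * kernelHom n * x ∈ stabHom.range := fun x => by
    have := (inferInstance : H.normalCore.Normal).conj_mem _ hh x⁻¹
    rw [inv_inv] at this
    exact hU _ (H.normalCore_le this) (hproj _ this)
  have hall : ∀ x : bigGroup, functional x.1.perm n.three = 0 ∧
      pairing n.five (axis (x.1.perm 0) (redThree (x.1.coord (x.1.perm 0)))) = 0 := fun x => by
    obtain ⟨m, hm, h₁, s, h₂⟩ := conj_kernelHom x n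
    have := hconj x
    rw [hm, kernelHom_mem_range_stabHom, h₁, h₂] at this
    refine ⟨this.1, ?_⟩
    have h3 := congrArg (s • ·) this.2
    simpa [smul_smul, Int.units_mul_self] using h3
  have h3 := eq_zero_of_functional_eq_zero n.three fun j k => (hall _).1
  have h5 := eq_zero_of_pairing_eq_zero n.five fun i c => by
    obtain ⟨j, k, rfl, rfl⟩ := exists_mover_perm_eq i c
    exact (hall _).2
  have hn : n = 1 := KernelModel.ext' (funext h3) (funext h5)
  rw [hn, map_one]
  exact Subgroup.mem_bot.2 rfl

/-- The stabilizer is the product of `stabHom.range` and the image of `s`; `hn` is its index formula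
with the common factor `3³ · 5²` cancelled. -/
theorem exists_isElusive {K : Type*} [Group K] [Finite K] (s : K →* bigGroup)
    (hs : Function.Injective (proj.comp s)) (hsq : ∀ k : K, k * k = 1)
    (hnorm : ∀ k, s k ∈ Subgroup.normalizer (stabHom.range : Set bigGroup))
    (hA : kleinA ∈ s.range) {n : ℕ} (hn : n * Nat.card K = 2 ^ 2 * 3 ^ 2 * 5 ^ 2) :
    ∃ P : Subgroup (Perm (Fin n)), Nonempty (bigGroup ≃* P) ∧ IsElusive P ∧
      ∀ ω : Fin n, IsSplitExtensionOf (MulAction.stabilizer P ω) StabModel K := by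
  obtain ⟨H, hH⟩ := exists_subgroup_mem_iff stabHom s hnorm
  have hcard := card_of_mem_iff H stabHom s proj stabHom_injective proj_stabHom hs hH
  have hsplit := isSplitExtensionOf_of_mem_iff H stabHom s proj stabHom_injective proj_stabHom hs hH
  have hindex : H.index = n := by
    have h := H.card_mul_index
    have hpos : 0 < Nat.card H := Nat.card_pos
    refine Nat.eq_of_mul_eq_mul_left hpos ?_
    rw [h, natCard_eq, hcard, natCard_stabModel, mul_assoc (3 ^ 3 * 5 ^ 2), mul_comm (Nat.card K), hn]
    norm_num
  have hU : stabHom.range ≤ H := by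
    rintro _ ⟨u, rfl⟩
    exact (hH _).2 ⟨u, 1, by simp⟩
  have hAH : kleinA ∈ H := by
    obtain ⟨k, hk⟩ := hA
    exact (hH _).2 ⟨1, k, by simp [hk]⟩
  have hcore : H.normalCore = ⊥ := by
    refine normalCore_eq_bot (fun h hh h1 => ?_) fun h hh => ?_
    · obtain ⟨u, k, rfl⟩ := (hH h).1 hh
      have hk : k = 1 := hs (by simpa [proj_stabHom] using h1)
      exact ⟨u, by simp [hk]⟩
    · obtain ⟨u, k, rfl⟩ := (hH h).1 hh
      rw [map_mul, proj_stabHom, one_mul, ← map_mul, ← map_mul, hsq, map_one, map_one]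
  obtain ⟨P, e, hP, hstab⟩ := exists_isElusive_of_normalCore_eq_bot H hindex hcore
    (exists_conj_mem hU hAH)
  refine ⟨P, e, hP, fun ω => ?_⟩
  obtain ⟨e'⟩ := hstab ω
  exact hsplit.of_mulEquiv e'

end bigGroup

theorem theorem1p2 :
    ∃ (X₁ : Subgroup (Equiv.Perm (Fin (3 ^ 2 * 5 ^ 2))))
      (X₂ : Subgroup (Equiv.Perm (Fin (2 * 3 ^ 2 * 5 ^ 2)))),
      -- the two permutation groups are the same abstract group
      Nonempty (X₁ ≃* X₂) ∧
      -- the elusive group of degree 225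
      (IsElusive X₁ ∧
        IsNonSplitExtensionOf X₁
          ((Fin 4 → CyclicGrp 3) × (Fin 3 → CyclicGrp 5)) (alternatingGroup (Fin 5)) ∧
        ∀ ω : Fin (3 ^ 2 * 5 ^ 2),
          IsSplitExtensionOf (MulAction.stabilizer X₁ ω)
            ((Fin 3 → CyclicGrp 3) × (Fin 2 → CyclicGrp 5)) (Fin 2 → CyclicGrp 2)) ∧
      -- the elusive group of degree 450
      (IsElusive X₂ ∧
        IsNonSplitExtensionOf X₂
          ((Fin 4 → CyclicGrp 3) × (Fin 3 → CyclicGrp 5)) (alternatingGroup (Fin 5)) ∧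
        ∀ ω : Fin (2 * 3 ^ 2 * 5 ^ 2),
          IsSplitExtensionOf (MulAction.stabilizer X₂ ω)
            ((Fin 3 → CyclicGrp 3) × (Fin 2 → CyclicGrp 5)) (CyclicGrp 2)) := by
  have hinv : ∀ k : CyclicGrp 2, k * k = 1 := by decide +kernel
  have hinj : Function.Injective
      (bigGroup.proj.comp (involutionHom bigGroup.kleinA bigGroup.kleinA_mul_self)) := by
    rw [injective_iff_map_eq_one]
    have : ∀ k : ZMod 2, (bigGroup.kleinA ^ k.val).1.perm = 1 → k = 0 := by decide +kernel
    exact fun k hk => this k (bigGroup.proj_eq_one_iff.1 hk)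
  -- The whole Klein four-group gives degree 225; `kleinA` alone halves the stabilizer and gives
  -- degree 450.
  obtain ⟨X₁, ⟨e₁⟩, h₁, hs₁⟩ := bigGroup.exists_isElusive bigGroup.kleinHom
    bigGroup.proj_comp_kleinHom_injective (fun k => funext fun i => hinv (k i))
    (fun k => mul_mem (pow_mem bigGroup.kleinA_mem_normalizer _)
      (pow_mem bigGroup.kleinB_mem_normalizer _))
    ⟨![Multiplicative.ofAdd 1, 1], by
      change bigGroup.kleinA ^ 1 * bigGroup.kleinB ^ 0 = _
      rw [pow_one, pow_zero, mul_one]⟩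
    (n := 3 ^ 2 * 5 ^ 2) (by simp [CyclicGrp])
  obtain ⟨X₂, ⟨e₂⟩, h₂, hs₂⟩ := bigGroup.exists_isElusive
    (involutionHom bigGroup.kleinA bigGroup.kleinA_mul_self) hinj hinv
    (fun k => pow_mem bigGroup.kleinA_mem_normalizer _)
    ⟨Multiplicative.ofAdd 1, pow_one _⟩
    (n := 2 * 3 ^ 2 * 5 ^ 2) (by simp [CyclicGrp])
  exact ⟨X₁, X₂, ⟨e₁.symm.trans e₂⟩, ⟨h₁, bigGroup.isNonSplitExtensionOf.of_mulEquiv e₁, hs₁⟩,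
    ⟨h₂, bigGroup.isNonSplitExtensionOf.of_mulEquiv e₂, hs₂⟩⟩
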